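/- For complex numbers $a,q$ and $n\in\mathbb{N}$ let $(a;q)_n=\prod_{i=0}^{n-1}(1-aq^i)$, with $(a;q)_0=1$, and for $|q|<1$ let $(a;q)_\infty=\prod_{i=0}^{\infty}(1-aq^i)$. Let $q\in\mathbb{C}$ with $|q|<1$. Then the series below converges absolutely and $$\sum_{n=0}^{\infty}\frac{(-1)^n q^{n^2+2n}\,(q;q^2)_n}{(-q;q^2)_n\,(q^4;q^4)_n}=\frac{(-q;q^5)_\infty\,(-q^4;q^5)_\infty\,(q^5;q^5)_\infty\,(q;q^2)_\infty}{(q^2;q^2)_\infty}.$$ -/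

import Mathlib

/-- The finite `q`-shifted factorial `(a; q)_n = ∏_{i=0}^{n-1} (1 - a q^i)`. -/
noncomputable def qPoch (a q : ℂ) (n : ℕ) : ℂ :=
  ∏ i ∈ Finset.range n, (1 - a * q ^ i)

/-- The infinite `q`-shifted factorial `(a; q)_∞ = ∏_{i=0}^{∞} (1 - a q^i)`, for `|q| < 1`. -/
noncomputable def qPochInf (a q : ℂ) : ℂ :=
  ∏' i : ℕ, (1 - a * q ^ i)

/-- For `|q| < 1` the product defining `(a; q)_∞` converges. -/
theorem hasProd_qPochInf (a : ℂ) {q : ℂ} (hq : ‖q‖ < 1) :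
    HasProd (fun i : ℕ => 1 - a * q ^ i) (qPochInf a q) := by
  have hs : Summable (fun i : ℕ => ‖-(a * q ^ i)‖) := by
    simpa [norm_mul, norm_pow] using
      (summable_geometric_of_lt_one (norm_nonneg q) hq).mul_left ‖a‖
  simpa [sub_eq_add_neg, qPochInf] using (multipliable_one_add_of_summable hs).hasProd

/-- The factors of `(a; q)_n` and `(a; q)_∞` do not vanish when `|a| < 1` and `|q| < 1`. -/
theorem one_sub_mul_pow_ne_zero {a q : ℂ} (ha : ‖a‖ < 1) (hq : ‖q‖ < 1) (i : ℕ) :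
    1 - a * q ^ i ≠ 0 := by
  intro h
  have h1 : ‖a * q ^ i‖ = 1 := by rw [← sub_eq_zero.mp h, norm_one]
  have h2 : ‖a * q ^ i‖ ≤ ‖a‖ := by
    rw [norm_mul, norm_pow]
    exact mul_le_of_le_one_right (norm_nonneg a) (pow_le_one₀ (norm_nonneg q) hq.le)
  linarith

/-- `(a; q)_n ≠ 0` when `|a| < 1` and `|q| < 1`. -/
theorem qPoch_ne_zero {a q : ℂ} (ha : ‖a‖ < 1) (hq : ‖q‖ < 1) (n : ℕ) : qPoch a q n ≠ 0 :=
  Finset.prod_ne_zero_iff.mpr fun i _ => one_sub_mul_pow_ne_zero ha hq i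

/-- `(a; q)_∞ ≠ 0` when `|a| < 1` and `|q| < 1`. -/
theorem qPochInf_ne_zero {a q : ℂ} (ha : ‖a‖ < 1) (hq : ‖q‖ < 1) : qPochInf a q ≠ 0 := by
  have hs : Summable (fun i : ℕ => ‖-(a * q ^ i)‖) := by
    simpa [norm_mul, norm_pow] using
      (summable_geometric_of_lt_one (norm_nonneg q) hq).mul_left ‖a‖
  have h := tprod_one_add_ne_zero_of_summable (f := fun i : ℕ => -(a * q ^ i))
    (fun i => by simpa [sub_eq_add_neg] using one_sub_mul_pow_ne_zero ha hq i) hs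
  simpa [sub_eq_add_neg, qPochInf] using h

/-!
The identity comes from a Bailey pair relative to `a = q²` in base `q²`, inserted in the confluent
Bailey lemma, and from Jacobi's triple product.

Write `U m = 1 / (p; p)_m`. In base `p = q²` the coefficients
`α_r = (-1)^r q^(r(3r-1)/2) (1 - q^(4r+2))` satisfy
`∑_{r ≤ n} α_r U (n-r) U (n+r+1) = 1 / ((-q; q²)_n (q⁴; q⁴)_n)` (`sum_pairCoeff`). Substituting this
in the series and interchanging the two summations leaves, for each `r`, a confluent `q`-Gauss sum
`∑_m (a; q)_m (-1)^m q^(m(m-1)/2) z^m / ((q; q)_m (az; q)_m) = (z; q)_∞ / (az; q)_∞`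
(`tsum_gaussTerm`), whose value turns `α_r` into `q^((5r²+3r)/2) (1 + q^(2r+1))` times
`(q; q²)_∞ / (q²; q²)_∞` (`tsum_doubleTerm`). These are the terms with indices `r` and `-r-1` of the
bilateral series `∑ q^((5j²+3j)/2)`, which the triple product with `x = q⁴`, `y = q` sums
(`hasSum_thetaCoeff`).

The triple product is itself the limit of a finite sum of the same shape as the Bailey pair
(`sum_thetaCoeff`). Both finite sums are evaluated by induction on `n`: a suitable combination of
the summands for `n + 1` and for `n` telescopes in `r`. With the factors `U` as the only reciprocals,
the telescoping identities are polynomial, so `q = 0` needs no separate treatment.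
-/

open Filter Topology

/-! ### Finite and infinite `q`-shifted factorials -/

theorem qPoch_zero (a q : ℂ) : qPoch a q 0 = 1 := by simp [qPoch]

theorem qPoch_succ (a q : ℂ) (n : ℕ) : qPoch a q (n + 1) = qPoch a q n * (1 - a * q ^ n) :=
  Finset.prod_range_succ _ _

theorem qPoch_add (a q : ℂ) (n m : ℕ) :
    qPoch a q (n + m) = qPoch a q n * qPoch (a * q ^ n) q m := by
  simp [qPoch, Finset.prod_range_add, pow_add, mul_assoc]

theorem tendsto_qPoch (a : ℂ) {q : ℂ} (hq : ‖q‖ < 1) :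
    Tendsto (qPoch a q) atTop (𝓝 (qPochInf a q)) :=
  (hasProd_qPochInf a hq).tendsto_prod_nat

theorem qPochInf_eq_qPoch_mul (a : ℂ) {q : ℂ} (hq : ‖q‖ < 1) (n : ℕ) :
    qPochInf a q = qPoch a q n * qPochInf (a * q ^ n) q := by
  refine tendsto_nhds_unique ((tendsto_qPoch a hq).comp (tendsto_add_atTop_nat n)) ?_
  refine ((tendsto_qPoch (a * q ^ n) hq).const_mul (qPoch a q n)).congr fun m => ?_
  rw [Function.comp_apply, add_comm m n, qPoch_add]

theorem exists_norm_le_of_tendsto {f : ℕ → ℂ} {l : ℂ} (h : Tendsto f atTop (𝓝 l)) :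
    ∃ C, 0 ≤ C ∧ ∀ n, ‖f n‖ ≤ C := by
  obtain ⟨C, hC⟩ := isBounded_iff_forall_norm_le.1 (Metric.isBounded_range_of_tendsto f h)
  exact ⟨C, (norm_nonneg _).trans (hC _ ⟨0, rfl⟩), fun n => hC _ ⟨n, rfl⟩⟩

/-- The reciprocal `1 / (p; p)_n`. -/
noncomputable def invPoch (p : ℂ) (n : ℕ) : ℂ := (qPoch p p n)⁻¹

theorem invPoch_zero (p : ℂ) : invPoch p 0 = 1 := by simp [invPoch, qPoch_zero]

/-- Descending from `n + 1` to `n`, so that identities between values of `invPoch` become polynomial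
in the deepest one. -/
theorem invPoch_eq {p : ℂ} (hp : ‖p‖ < 1) (n : ℕ) :
    invPoch p n = (1 - p ^ (n + 1)) * invPoch p (n + 1) := by
  have h := one_sub_mul_pow_ne_zero hp hp n
  rw [invPoch, invPoch, qPoch_succ, mul_inv, pow_succ']
  field_simp

theorem tendsto_invPoch {p : ℂ} (hp : ‖p‖ < 1) :
    Tendsto (invPoch p) atTop (𝓝 (qPochInf p p)⁻¹) :=
  (tendsto_qPoch p hp).inv₀ (qPochInf_ne_zero hp hp)

/-! ### Two finite summations -/

/-- The `α`-sequence of the Bailey pair, `(-1)^r q^(r(3r-1)/2) (1 - q^(4r+2))`; the exponent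
`r(3r-1)/2` is written `3 * r.choose 2 + r` to avoid subtraction and division in `ℕ`. -/
noncomputable def pairCoeff (q : ℂ) (r : ℕ) : ℂ :=
  (-1) ^ r * q ^ (3 * r.choose 2 + r) * (1 - q ^ (4 * r + 2))

/-- The telescoping behind `sum_pairCoeff`, with `n = k + s`. The right-hand side is the WZ-type
certificate at `r = k + 1`: it vanishes formally at `r = 0`, where it would involve negative powers
of `q`, so partial sums start with one term. -/
theorem pair_telescope {q : ℂ} (hq : ‖q ^ 2‖ < 1) (k s : ℕ) :
    ∑ r ∈ Finset.range (k + 1),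
      ((1 - q ^ (4 * (k + s) + 4)) * (1 + q ^ (2 * (k + s) + 1)) *
          (pairCoeff q r * invPoch (q ^ 2) (k + s + 1 - r) * invPoch (q ^ 2) (k + s + 1 + r + 1)) -
        pairCoeff q r * invPoch (q ^ 2) (k + s - r) * invPoch (q ^ 2) (k + s + r + 1)) =
    (-1) ^ (k + 1) * q ^ (3 * (k + 1).choose 2 + (k + 1)) *
      invPoch (q ^ 2) s * invPoch (q ^ 2) (2 * k + s + 2) *
      (q ^ (5 * k + 2 * s + 5) - q ^ (2 * s) + q ^ (6 * k + 4 * s + 5) - q ^ (3 * k + 4 * s + 2) +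
        (q ^ (2 * k + 2 * s + 1) - q ^ (4 * k + 4 * s + 4)) * (q ^ (k + 1) - 1)) := by
  induction k generalizing s with
  | zero =>
    have h1 := invPoch_eq hq s
    have h2 := invPoch_eq hq (s + 1)
    simp only [zero_add, Finset.range_one, Finset.sum_singleton, Nat.sub_zero, add_zero, mul_zero,
      pairCoeff, Nat.choose_succ_self, Nat.choose_zero_succ, pow_zero, mul_one]
    rw [h1, h2]
    ring
  | succ k ih =>
    have ih := ih (s + 1)
    rw [show k + (s + 1) = k + 1 + s by ring] at ih
    rw [Finset.sum_range_succ, ih, show k + 1 + s + 1 - (k + 1) = s + 1 by omega,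
      show k + 1 + s - (k + 1) = s by omega, show k + 1 + s + 1 + (k + 1) + 1 = 2 * k + s + 4 by ring,
      show k + 1 + s + (k + 1) + 1 = 2 * k + s + 3 by ring,
      show 2 * k + (s + 1) + 2 = 2 * k + s + 3 by ring,
      show 2 * (k + 1) + s + 2 = 2 * k + s + 4 by ring, invPoch_eq hq s,
      invPoch_eq hq (2 * k + s + 3), pairCoeff,
      show (k + 1 + 1).choose 2 = (k + 1) + (k + 1).choose 2 by
        rw [Nat.choose_succ_succ' (k + 1) 1, Nat.choose_one_right]]
    ring

/-- The Bailey pair: `pairCoeff` corresponds to `β_n = 1 / ((-q; q²)_n (q⁴; q⁴)_n)`. -/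
theorem sum_pairCoeff {q : ℂ} (hq : ‖q‖ < 1) (n : ℕ) :
    ∑ r ∈ Finset.range (n + 1),
      pairCoeff q r * invPoch (q ^ 2) (n - r) * invPoch (q ^ 2) (n + r + 1) =
    (qPoch (-q) (q ^ 2) n * qPoch (q ^ 4) (q ^ 4) n)⁻¹ := by
  have hpow : ∀ k ≠ 0, ‖q ^ k‖ < 1 := fun k hk => by
    rw [norm_pow]; exact pow_lt_one₀ (norm_nonneg _) hq hk
  have hq2 := hpow 2 (by norm_num)
  have hq4 := hpow 4 (by norm_num)
  induction n with
  | zero =>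
    have h := one_sub_mul_pow_ne_zero hq2 hq2 0
    simp only [pow_zero, mul_one] at h
    simp [qPoch, invPoch, pairCoeff, h]
  | succ n ih =>
    have h := pair_telescope hq2 n 0
    rw [Finset.sum_sub_distrib, ← Finset.mul_sum] at h
    simp only [add_zero] at h
    have h1 : 1 - q ^ (4 * n + 4) ≠ 0 := by
      convert one_sub_mul_pow_ne_zero hq4 hq4 n using 2; ring
    have h2 : 1 + q ^ (2 * n + 1) ≠ 0 := by
      have := one_sub_mul_pow_ne_zero (a := -q) (by simpa using hq) hq2 n
      convert this using 1; ring
    -- The certificate at `r = n + 1` cancels the last summand, present only for `n + 1`.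
    have key : (1 - q ^ (4 * n + 4)) * (1 + q ^ (2 * n + 1)) *
        ∑ r ∈ Finset.range (n + 1 + 1),
          pairCoeff q r * invPoch (q ^ 2) (n + 1 - r) * invPoch (q ^ 2) (n + 1 + r + 1) =
        (qPoch (-q) (q ^ 2) n * qPoch (q ^ 4) (q ^ 4) n)⁻¹ := by
      rw [Finset.sum_range_succ, mul_add, ← ih, eq_comm, ← sub_eq_iff_eq_add', ← neg_sub, h,
        Nat.sub_self, invPoch_zero, invPoch_eq hq2 (2 * n + 0 + 2), pairCoeff,
        show n + 1 + (n + 1) + 1 = 2 * n + 0 + 2 + 1 by ring]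
      ring
    have e : qPoch (-q) (q ^ 2) (n + 1) * qPoch (q ^ 4) (q ^ 4) (n + 1) =
        (1 - q ^ (4 * n + 4)) * (1 + q ^ (2 * n + 1)) *
          (qPoch (-q) (q ^ 2) n * qPoch (q ^ 4) (q ^ 4) n) := by
      rw [qPoch_succ, qPoch_succ]; ring
    rw [e, mul_inv, ← key]
    field_simp

/-- The terms of index `r` and `-r-1` of the bilateral theta series
`∑_j x^(j(j+1)/2) y^(j(j-1)/2)`, added together. -/
noncomputable def thetaCoeff (x y : ℂ) (r : ℕ) : ℂ :=
  x ^ r * (x * y) ^ r.choose 2 * (1 + y ^ (2 * r + 1))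

/-- The telescoping behind `sum_thetaCoeff`. The right-hand side is `G k - G (-k)`, where `G` is the
certificate that two applications of the `q`-Pascal rule give for the bilateral form of the sum. -/
theorem theta_telescope {x y : ℂ} (hp : ‖x * y‖ < 1) (k s n : ℕ) (hn : n + 1 = k + s) :
    ∑ r ∈ Finset.range k,
      ((1 - (x * y) ^ (2 * n + 2)) * (1 - (x * y) ^ (2 * n + 3)) *
          (thetaCoeff x y r * invPoch (x * y) (n + 1 - r) * invPoch (x * y) (n + 1 + r + 1)) -
        (1 + x * (x * y) ^ n) * (1 + y * (x * y) ^ (n + 1)) *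
          (thetaCoeff x y r * invPoch (x * y) (n - r) * invPoch (x * y) (n + r + 1))) =
    (x * y) ^ k.choose 2 * invPoch (x * y) s * invPoch (x * y) (n + 1 + k) *
      (y * (x * y) ^ (n + 1) * (1 - (x * y) ^ (2 * n + 2)) * (x ^ k - y ^ k) -
        (1 + y * (x * y) ^ (n + 1)) *
          ((x * y) ^ s * (1 - (x * y) ^ (n + 1 + k)) * x ^ k -
            (x * y) ^ (n + 1 + k) * (1 - (x * y) ^ s) * y ^ k)) := by
  induction k generalizing s with
  | zero =>
    obtain rfl : s = n + 1 := by omega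
    simp
  | succ k ih =>
    obtain rfl : n = k + s := by omega
    rw [Finset.sum_range_succ, ih (s + 1) (by omega), show k + s + 1 - k = s + 1 by omega,
      show k + s - k = s by omega, show k + s + 1 + (k + 1) = 2 * k + s + 2 by ring,
      show k + s + k + 1 = 2 * k + s + 1 by ring,
      show k + s + 1 + k + 1 = 2 * k + s + 2 by ring,
      show k + s + 1 + k = 2 * k + s + 1 by ring, invPoch_eq hp s,
      invPoch_eq hp (2 * k + s + 1), thetaCoeff,
      show (k + 1).choose 2 = k + k.choose 2 by
        rw [Nat.choose_succ_succ' k 1, Nat.choose_one_right]]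
    ring

/-- The finite form of Jacobi's triple product, over an odd number `2n + 1` of factors. -/
theorem sum_thetaCoeff {x y : ℂ} (hp : ‖x * y‖ < 1) (n : ℕ) :
    ∑ r ∈ Finset.range (n + 1),
      thetaCoeff x y r * invPoch (x * y) (n - r) * invPoch (x * y) (n + r + 1) =
    qPoch (-x) (x * y) n * qPoch (-y) (x * y) (n + 1) * invPoch (x * y) (2 * n + 1) := by
  induction n with
  | zero => simp [qPoch, invPoch, thetaCoeff]
  | succ n ih =>
    have h := theta_telescope hp (n + 1) 0 n (by omega)
    rw [Finset.sum_sub_distrib, ← Finset.mul_sum, ← Finset.mul_sum, ih] at h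
    have h1 : 1 - (x * y) ^ (2 * n + 2) ≠ 0 := by
      simpa only [pow_succ'] using one_sub_mul_pow_ne_zero hp hp (2 * n + 1)
    have h2 : 1 - (x * y) ^ (2 * n + 3) ≠ 0 := by
      simpa only [pow_succ'] using one_sub_mul_pow_ne_zero hp hp (2 * n + 2)
    apply mul_left_cancel₀ (mul_ne_zero h1 h2)
    rw [Finset.sum_range_succ, mul_add, sub_eq_iff_eq_add.1 h, Nat.sub_self, invPoch_zero,
      show 2 * (n + 1) + 1 = 2 * n + 1 + 1 + 1 by ring, invPoch_eq hp (2 * n + 1),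
      invPoch_eq hp (2 * n + 1 + 1), show n + 1 + (n + 1) = 2 * n + 1 + 1 by ring,
      invPoch_eq hp (2 * n + 1 + 1), thetaCoeff, qPoch_succ (-x), qPoch_succ (-y) _ (n + 1)]
    ring

/-! ### Jacobi's triple product -/

theorem summable_thetaCoeff_norm {x y : ℂ} (hx : ‖x‖ < 1) (hy : ‖y‖ < 1) :
    Summable fun r => ‖thetaCoeff x y r‖ := by
  have hp : ‖x * y‖ ≤ 1 := by
    rw [norm_mul]; exact mul_le_one₀ hx.le (norm_nonneg _) hy.le
  refine Summable.of_nonneg_of_le (fun _ => norm_nonneg _) (fun r => ?_)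
    ((summable_geometric_of_lt_one (norm_nonneg x) hx).mul_right 2)
  rw [thetaCoeff, norm_mul, norm_mul, norm_pow, norm_pow]
  have h1 : ‖x * y‖ ^ r.choose 2 ≤ 1 := pow_le_one₀ (norm_nonneg _) hp
  have h2 : ‖1 + y ^ (2 * r + 1)‖ ≤ 2 := by
    refine (norm_add_le _ _).trans ?_
    rw [norm_one, norm_pow]
    linarith [pow_le_one₀ (n := 2 * r + 1) (norm_nonneg y) hy.le]
  have h3 : ‖x‖ ^ r * ‖x * y‖ ^ r.choose 2 ≤ ‖x‖ ^ r :=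
    mul_le_of_le_one_right (by positivity) h1
  exact mul_le_mul h3 h2 (norm_nonneg _) (by positivity)

/-- Jacobi's triple product, as the limit of `sum_thetaCoeff` under dominated convergence. -/
theorem hasSum_thetaCoeff {x y : ℂ} (hx : ‖x‖ < 1) (hy : ‖y‖ < 1) :
    HasSum (thetaCoeff x y)
      (qPochInf (-y) (x * y) * qPochInf (-x) (x * y) * qPochInf (x * y) (x * y)) := by
  have hp : ‖x * y‖ < 1 := by
    rw [norm_mul]; exact mul_lt_one_of_nonneg_of_lt_one_left (norm_nonneg _) hx hy.le
  have hs := summable_thetaCoeff_norm hx hy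
  obtain ⟨C, hC0, hC⟩ := exists_norm_le_of_tendsto (tendsto_invPoch hp)
  set P := qPochInf (x * y) (x * y)
  have hP0 : P ≠ 0 := qPochInf_ne_zero hp hp
  have hlim : Tendsto (fun n => ∑' r, if r ∈ Finset.range (n + 1) then
      thetaCoeff x y r * invPoch (x * y) (n - r) * invPoch (x * y) (n + r + 1) else 0) atTop
      (𝓝 (∑' r, thetaCoeff x y r * P⁻¹ * P⁻¹)) := by
    refine tendsto_tsum_of_dominated_convergence ((hs.mul_right C).mul_right C) (fun r => ?_)
      (Eventually.of_forall fun n r => ?_)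
    · have e1 : Tendsto (fun n => invPoch (x * y) (n - r)) atTop (𝓝 P⁻¹) :=
        (tendsto_invPoch hp).comp (tendsto_sub_atTop_nat r)
      have e2 : Tendsto (fun n => invPoch (x * y) (n + r + 1)) atTop (𝓝 P⁻¹) :=
        (tendsto_invPoch hp).comp (tendsto_add_atTop_nat (r + 1))
      refine ((e1.const_mul _).mul e2).congr' ?_
      filter_upwards [eventually_ge_atTop r] with n hn
      rw [if_pos (Finset.mem_range.2 (by omega))]
    · split_ifs
      · rw [norm_mul, norm_mul]
        gcongr
        · exact hC _
        · exact hC _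
      · rw [norm_zero]; positivity
  have hlim' : Tendsto (fun n => qPoch (-x) (x * y) n * qPoch (-y) (x * y) (n + 1) *
      invPoch (x * y) (2 * n + 1)) atTop
      (𝓝 (qPochInf (-x) (x * y) * qPochInf (-y) (x * y) * P⁻¹)) := by
    refine ((tendsto_qPoch _ hp).mul ((tendsto_qPoch _ hp).comp (tendsto_add_atTop_nat 1))).mul
      ((tendsto_invPoch hp).comp (tendsto_atTop_mono (fun n => ?_) tendsto_id))
    simp only [id]; omega
  have heq := tendsto_nhds_unique hlim (hlim'.congr fun n => by
    rw [← sum_thetaCoeff hp, tsum_eq_sum (s := Finset.range (n + 1))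
      fun r hr => if_neg hr]
    exact Finset.sum_congr rfl fun r hr => (if_pos hr).symm)
  rw [tsum_mul_right, tsum_mul_right] at heq
  have : ∑' r, thetaCoeff x y r = qPochInf (-y) (x * y) * qPochInf (-x) (x * y) * P := by
    field_simp at heq
    linear_combination heq
  rw [← this]
  exact hs.of_norm.hasSum

/-! ### A confluent `q`-Gauss sum -/

/-- The `m`-th term of the confluent `q`-Gauss series with parameters `a` and `z q^k`, divided by
`(az; q)_k`: since `(az; q)_k (az q^k; q)_m = (az; q)_{m+k}`, this division makes the bounds uniform
in `k`. -/
noncomputable def gaussTerm (a z q : ℂ) (k m : ℕ) : ℂ :=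
  qPoch a q m * ((-1) ^ m * q ^ m.choose 2 * (z * q ^ k) ^ m) * invPoch q m *
    (qPoch (a * z) q (m + k))⁻¹

theorem exists_norm_gaussTerm_le (a : ℂ) {z q : ℂ} (hq : ‖q‖ < 1) (haz : ‖a * z‖ < 1) :
    ∃ C, ∀ k m, ‖gaussTerm a z q k m‖ ≤ C * ‖z‖ ^ m := by
  obtain ⟨A, hA0, hA⟩ := exists_norm_le_of_tendsto (tendsto_qPoch a hq)
  obtain ⟨B, hB0, hB⟩ := exists_norm_le_of_tendsto (tendsto_invPoch hq)
  obtain ⟨D, hD0, hD⟩ := exists_norm_le_of_tendsto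
    ((tendsto_qPoch (a * z) hq).inv₀ (qPochInf_ne_zero haz hq))
  refine ⟨A * B * D, fun k m => ?_⟩
  have h : ‖(-1) ^ m * q ^ m.choose 2 * (z * q ^ k) ^ m‖ ≤ ‖z‖ ^ m := by
    rw [norm_mul, norm_mul, norm_pow, norm_neg, norm_one, one_pow, one_mul, norm_pow, norm_pow,
      norm_mul, norm_pow]
    refine (mul_le_of_le_one_left (by positivity) (pow_le_one₀ (norm_nonneg _) hq.le)).trans ?_
    exact pow_le_pow_left₀ (by positivity)
      (mul_le_of_le_one_right (norm_nonneg _) (pow_le_one₀ (norm_nonneg _) hq.le)) _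
  rw [gaussTerm, norm_mul, norm_mul, norm_mul]
  calc _ ≤ A * ‖z‖ ^ m * B * D := by
        gcongr
        · exact hA _
        · exact hB _
        · exact hD _
    _ = _ := by ring

theorem summable_gaussTerm (a : ℂ) {z q : ℂ} (hq : ‖q‖ < 1) (hz : ‖z‖ < 1) (haz : ‖a * z‖ < 1)
    (k : ℕ) : Summable (gaussTerm a z q k) := by
  obtain ⟨C, hC⟩ := exists_norm_gaussTerm_le a hq haz
  exact .of_norm_bounded ((summable_geometric_of_lt_one (norm_nonneg z) hz).mul_left C) (hC k)

/-- The difference telescopes in `m`, which gives the recurrence `tsum_gaussTerm_succ`. -/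
theorem gaussTerm_sub (a : ℂ) {z q : ℂ} (hq : ‖q‖ < 1) (haz : ‖a * z‖ < 1) (k m : ℕ) :
    gaussTerm a z q k m - (1 - z * q ^ k) * gaussTerm a z q (k + 1) m =
      (1 - q ^ m) * gaussTerm a z q k m - (1 - q ^ (m + 1)) * gaussTerm a z q k (m + 1) := by
  have h1 := one_sub_mul_pow_ne_zero haz hq (m + k)
  have h2 : (qPoch (a * z) q (m + k))⁻¹ =
      (1 - a * z * q ^ (m + k)) * (qPoch (a * z) q (m + k + 1))⁻¹ := by
    rw [qPoch_succ, mul_inv]; field_simp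
  rw [gaussTerm, gaussTerm, gaussTerm, ← add_assoc m k 1, add_right_comm m 1 k, h2,
    invPoch_eq hq m, qPoch_succ a,
    show (m + 1).choose 2 = m + m.choose 2 by
      rw [Nat.choose_succ_succ' m 1, Nat.choose_one_right]]
  ring

theorem tsum_gaussTerm_succ (a : ℂ) {z q : ℂ} (hq : ‖q‖ < 1) (hz : ‖z‖ < 1) (haz : ‖a * z‖ < 1)
    (k : ℕ) :
    ∑' m, gaussTerm a z q k m = (1 - z * q ^ k) * ∑' m, gaussTerm a z q (k + 1) m := by
  have h0 := summable_gaussTerm a hq hz haz k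
  have h1 := summable_gaussTerm a hq hz haz (k + 1)
  have hg : Summable fun m => (1 - q ^ m) * gaussTerm a z q k m := by
    refine .of_norm_bounded (h0.norm.mul_left 2) fun m => ?_
    rw [norm_mul]
    gcongr
    refine (norm_sub_le _ _).trans ?_
    rw [norm_one, norm_pow]
    linarith [pow_le_one₀ (n := m) (norm_nonneg q) hq.le]
  have hg' := (summable_nat_add_iff 1).2 hg
  rw [← sub_eq_zero, ← tsum_mul_left, ← h0.tsum_sub (h1.mul_left _)]
  simp_rw [gaussTerm_sub a hq haz]
  rw [hg.tsum_sub hg', hg.tsum_eq_zero_add]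
  simp

/-- The confluent `q`-Gauss (`₁φ₁`) sum. Iterating the recurrence replaces `z` by `z q^k`, and as
`k → ∞` only the term `m = 0` survives. -/
theorem tsum_gaussTerm (a : ℂ) {z q : ℂ} (hq : ‖q‖ < 1) (hz : ‖z‖ < 1) (haz : ‖a * z‖ < 1) :
    ∑' m, gaussTerm a z q 0 m = qPochInf z q / qPochInf (a * z) q := by
  obtain ⟨C, hC⟩ := exists_norm_gaussTerm_le a hq haz
  have hrec : ∀ k, ∑' m, gaussTerm a z q 0 m = qPoch z q k * ∑' m, gaussTerm a z q k m := by
    intro k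
    induction k with
    | zero => simp [qPoch_zero]
    | succ k ih => rw [ih, qPoch_succ, tsum_gaussTerm_succ a hq hz haz, mul_assoc]
  have hlim : Tendsto (fun k => ∑' m, gaussTerm a z q k m) atTop
      (𝓝 (∑' m : ℕ, if m = 0 then (qPochInf (a * z) q)⁻¹ else 0)) := by
    refine tendsto_tsum_of_dominated_convergence
      ((summable_geometric_of_lt_one (norm_nonneg z) hz).mul_left C) (fun m => ?_)
      (Eventually.of_forall hC)
    have hinv : Tendsto (fun k => (qPoch (a * z) q (m + k))⁻¹) atTop
        (𝓝 (qPochInf (a * z) q)⁻¹) := by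
      simp_rw [add_comm m]
      exact ((tendsto_qPoch (a * z) hq).comp (tendsto_add_atTop_nat m)).inv₀
        (qPochInf_ne_zero haz hq)
    rcases Nat.eq_zero_or_pos m with rfl | hm
    · simpa [gaussTerm, qPoch_zero, invPoch_zero] using hinv
    · rw [if_neg hm.ne']
      have hpow : Tendsto (fun k => (z * q ^ k) ^ m) atTop (𝓝 0) := by
        simpa [hm.ne'] using ((tendsto_pow_atTop_nhds_zero_of_norm_lt_one hq).const_mul z).pow m
      simpa [gaussTerm] using
        (((hpow.const_mul ((-1) ^ m * q ^ m.choose 2)).const_mul (qPoch a q m)).mul_const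
          (invPoch q m)).mul hinv
  rw [tsum_ite_eq] at hlim
  have := tendsto_nhds_unique tendsto_const_nhds
    (((tendsto_qPoch z hq).mul hlim).congr fun k => (hrec k).symm)
  rw [this, div_eq_mul_inv]

/-! ### Interchanging the summations -/

/-- The double series obtained by expanding the `n`-th term of the original series by
`sum_pairCoeff`, indexed by `(r, m)` with `n = r + m`. -/
noncomputable def doubleTerm (q : ℂ) (rm : ℕ × ℕ) : ℂ :=
  (-1) ^ (rm.1 + rm.2) * q ^ ((rm.1 + rm.2) ^ 2 + 2 * (rm.1 + rm.2)) *
    qPoch q (q ^ 2) (rm.1 + rm.2) *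
    (pairCoeff q rm.1 * invPoch (q ^ 2) rm.2 * invPoch (q ^ 2) (rm.1 + rm.2 + rm.1 + 1))

theorem summable_doubleTerm {q : ℂ} (hq : ‖q‖ < 1) : Summable (doubleTerm q) := by
  have hq2 : ‖q ^ 2‖ < 1 := by
    rw [norm_pow]; exact pow_lt_one₀ (norm_nonneg _) hq (by norm_num)
  have hle : ∀ n, ‖q‖ ^ n ≤ 1 := fun n => pow_le_one₀ (norm_nonneg _) hq.le
  obtain ⟨A, hA0, hA⟩ := exists_norm_le_of_tendsto (tendsto_qPoch q hq2)
  obtain ⟨B, hB0, hB⟩ := exists_norm_le_of_tendsto (tendsto_invPoch hq2)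
  have hg := summable_geometric_of_lt_one (norm_nonneg q) hq
  refine .of_norm_bounded ((hg.mul_of_nonneg hg (fun _ => by positivity)
    fun _ => by positivity).mul_left (A * (2 * B * B))) ?_
  rintro ⟨r, m⟩
  have h1 : ‖pairCoeff q r‖ ≤ 2 := by
    rw [pairCoeff, norm_mul, norm_mul, norm_pow, norm_neg, norm_one, one_pow, one_mul, norm_pow]
    refine (mul_le_of_le_one_left (norm_nonneg _) (hle _)).trans ((norm_sub_le _ _).trans ?_)
    rw [norm_one, norm_pow]
    linarith [hle (4 * r + 2)]
  have h2 : ‖(-1 : ℂ) ^ (r + m) * q ^ ((r + m) ^ 2 + 2 * (r + m))‖ ≤ ‖q‖ ^ r * ‖q‖ ^ m := by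
    rw [norm_mul, norm_pow, norm_neg, norm_one, one_pow, one_mul, norm_pow, ← pow_add]
    exact pow_le_pow_of_le_one (norm_nonneg _) hq.le (by nlinarith)
  rw [doubleTerm, norm_mul, norm_mul _ (qPoch _ _ _), norm_mul (_ * _) (invPoch _ _),
    norm_mul _ (invPoch _ _)]
  calc _ ≤ ‖q‖ ^ r * ‖q‖ ^ m * A * (2 * B * B) :=
        mul_le_mul (mul_le_mul h2 (hA _) (norm_nonneg _) (by positivity))
          (mul_le_mul (mul_le_mul h1 (hB _) (norm_nonneg _) (by norm_num)) (hB _) (norm_nonneg _)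
            (by positivity)) (by positivity) (by positivity)
    _ = _ := by ring

theorem sum_antidiagonal_doubleTerm {q : ℂ} (hq : ‖q‖ < 1) (n : ℕ) :
    ∑ rm ∈ Finset.HasAntidiagonal.antidiagonal n, doubleTerm q rm =
      (-1) ^ n * q ^ (n ^ 2 + 2 * n) * qPoch q (q ^ 2) n /
        (qPoch (-q) (q ^ 2) n * qPoch (q ^ 4) (q ^ 4) n) := by
  rw [div_eq_mul_inv, ← sum_pairCoeff hq, Finset.Nat.sum_antidiagonal_eq_sum_range_succ_mk,
    Finset.mul_sum]
  refine Finset.sum_congr rfl fun r hr => ?_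
  have : r + (n - r) = n := Nat.add_sub_cancel' (Finset.mem_range_succ_iff.1 hr)
  simp only [doubleTerm, this]

/-- The inner sum is the confluent `q`-Gauss sum in base `q²` with `a = q^(2r+1)`, `z = q^(2r+3)`. -/
theorem tsum_doubleTerm {q : ℂ} (hq : ‖q‖ < 1) (r : ℕ) :
    ∑' m, doubleTerm q (r, m) =
      thetaCoeff (q ^ 4) q r * (qPochInf q (q ^ 2) / qPochInf (q ^ 2) (q ^ 2)) := by
  have hpow : ∀ k ≠ 0, ‖q ^ k‖ < 1 := fun k hk => by
    rw [norm_pow]; exact pow_lt_one₀ (norm_nonneg _) hq hk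
  have hq2 := hpow 2 (by norm_num)
  have ez : q ^ (2 * r + 1) * q ^ (2 * r + 3) = q ^ 2 * (q ^ 2) ^ (2 * r + 1) := by ring
  have hG := tsum_gaussTerm (q ^ (2 * r + 1)) hq2 (hpow (2 * r + 3) (by omega))
    (by rw [← pow_add]; exact hpow _ (by omega))
  have hterm : ∀ m, doubleTerm q (r, m) =
      ((-1) ^ r * q ^ (r ^ 2 + 2 * r) * qPoch q (q ^ 2) r * pairCoeff q r *
        invPoch (q ^ 2) (2 * r + 1)) *
        gaussTerm (q ^ (2 * r + 1)) (q ^ (2 * r + 3)) (q ^ 2) 0 m := by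
    intro m
    have hm : (q ^ 2) ^ m.choose 2 * q ^ m = q ^ (m ^ 2) := by
      rw [← pow_mul, ← pow_add]
      congr 1
      rw [Nat.choose_two_right, Nat.mul_div_cancel' (Nat.even_mul_pred_self m).two_dvd]
      cases m with
      | zero => rfl
      | succ m => simp; ring
    rw [doubleTerm, gaussTerm, ez, qPoch_add q, show r + m + r + 1 = 2 * r + 1 + m by ring,
      invPoch, invPoch, qPoch_add _ _ (2 * r + 1) m, invPoch, mul_inv, add_zero,
      show q * (q ^ 2) ^ r = q ^ (2 * r + 1) by ring,
      show q ^ ((r + m) ^ 2 + 2 * (r + m)) =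
        q ^ (r ^ 2 + 2 * r) * (q ^ (m ^ 2) * q ^ (2 * r * m + 2 * m)) by ring, ← hm]
    ring
  simp_rw [hterm]
  rw [tsum_mul_left, hG, ez, qPochInf_eq_qPoch_mul q hq2 (r + 1),
    qPochInf_eq_qPoch_mul (q ^ 2) hq2 (2 * r + 1), qPoch_succ q,
    show q * (q ^ 2) ^ (r + 1) = q ^ (2 * r + 3) by ring, invPoch, pairCoeff, thetaCoeff]
  have hexp : q ^ (r ^ 2 + 2 * r) * q ^ (3 * r.choose 2 + r) =
      (q ^ 4) ^ r * (q ^ 4 * q) ^ r.choose 2 := by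
    have : 2 * r.choose 2 + r = r ^ 2 := by
      rw [Nat.choose_two_right, Nat.mul_div_cancel' (Nat.even_mul_pred_self r).two_dvd]
      cases r with
      | zero => rfl
      | succ r => simp; ring
    rw [← this]
    ring
  have hsign : ((-1 : ℂ) ^ r) * (-1) ^ r = 1 := by rw [← mul_pow]; simp
  set D := qPoch (q ^ 2) (q ^ 2) (2 * r + 1)
  set E := qPochInf (q ^ 2 * (q ^ 2) ^ (2 * r + 1)) (q ^ 2)
  set Z := qPochInf (q ^ (2 * r + 3)) (q ^ 2)
  set K := qPoch q (q ^ 2) r * (1 - q ^ (4 * r + 2)) * D⁻¹ * Z * E⁻¹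
  linear_combination q ^ (r ^ 2 + 2 * r) * q ^ (3 * r.choose 2 + r) * K * hsign + K * hexp

theorem theorem4p1 (q : ℂ) (hq : ‖q‖ < 1) :
    HasSum
      (fun n : ℕ =>
        (-1) ^ n * q ^ (n ^ 2 + 2 * n) * qPoch q (q ^ 2) n /
          (qPoch (-q) (q ^ 2) n * qPoch (q ^ 4) (q ^ 4) n))
      (qPochInf (-q) (q ^ 5) * qPochInf (-q ^ 4) (q ^ 5) * qPochInf (q ^ 5) (q ^ 5) *
          qPochInf q (q ^ 2) / qPochInf (q ^ 2) (q ^ 2)) := by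
  have hs := summable_doubleTerm hq
  have hq4 : ‖q ^ 4‖ < 1 := by
    rw [norm_pow]; exact pow_lt_one₀ (norm_nonneg _) hq (by norm_num)
  have hθ := (hasSum_thetaCoeff hq4 hq).mul_right
    (qPochInf q (q ^ 2) / qPochInf (q ^ 2) (q ^ 2))
  have hrows := hs.hasSum.prod_fiberwise fun r => (hs.prod_factor r).hasSum
  simp_rw [tsum_doubleTerm hq] at hrows
  have hsum := hs.hasSum
  rw [hrows.unique hθ] at hsum
  have hdiag := (Finset.HasAntidiagonal.sigmaAntidiagonalEquivProd.hasSum_iff.2 hsum).sigma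
    fun n => hasSum_fintype _
  convert hdiag using 1
  · funext n
    rw [← sum_antidiagonal_doubleTerm hq, ← Finset.sum_coe_sort]
    rfl
  · ring_nf
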